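/- Call a family of $s$ distinct sets $\{F_1,\dots,F_s\}$ a sunflower with $s$ petals and core $C$ if $C=\bigcap_{u=1}^{s}F_u$ and $F_i\cap F_j=C$ for all distinct $i,j\in[s]$. Let $\phi(s,t)$ be the maximum size of a family of $t$-element sets (on an arbitrary ground set) that contains no sunflower with $s$ petals, whatever its core. There are a function $c(s,k)$ and an absolute constant $C>0$ with $$c(s,k)\le s^{2^k}\cdot 2^{2^{Ck}}\qquad\text{for all } s,k,$$ such that the following holds. Let $s\ge 2$, $t\ge 1$, $k\ge 2t+1$ and $n>k$ be integers, and let $\mathcal F\subset\binom{[n]}{k}$ be a family of $k$-element subsets of $[n]=\{1,\dots,n\}$ that contains no sunflower with $s$ petals and core of size $t-1$. Then $$|\mathcal F|\le \phi(s,t)\binom{n}{k-t}+\frac{k\cdot c(s,k)}{n-k}\binom{n}{k-t}.$$ -/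

import Mathlib

/-- The family `S` of (distinct) sets is a sunflower with core `C`: the set `C` is the common
intersection of all members of `S`, and any two distinct members of `S` intersect exactly in `C`.
The number of petals is the cardinality of `S`. -/
def IsSunflower {α : Type*} [DecidableEq α] (S : Finset (Finset α)) (C : Finset α) : Prop :=
  (∀ x, x ∈ C ↔ ∀ A ∈ S, x ∈ A) ∧ ∀ A ∈ S, ∀ B ∈ S, A ≠ B → A ∩ B = C

/-- The family `F` contains a sunflower with `s` petals (and arbitrary core). -/
def HasSunflower {α : Type*} [DecidableEq α] (s : ℕ) (F : Finset (Finset α)) : Prop :=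
  ∃ S ⊆ F, S.card = s ∧ ∃ C, IsSunflower S C

/-- The family `F` contains a sunflower with `s` petals and core of size `c`. -/
def HasSunflowerWithCoreCard {α : Type*} [DecidableEq α] (s c : ℕ)
    (F : Finset (Finset α)) : Prop :=
  ∃ S ⊆ F, S.card = s ∧ ∃ C, C.card = c ∧ IsSunflower S C

/-- `sunflowerPhi s t` is the maximum size of a `t`-uniform family that contains no sunflower
with `s` petals. There is no restriction on the ground set: every finite family of finite sets can
be realised on `ℕ`. (For `s ≥ 2` the set of sizes is nonempty, and it is bounded by the classical
sunflower lemma of Erdős and Rado, so that the supremum is a maximum.) -/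
noncomputable def sunflowerPhi (s t : ℕ) : ℕ :=
  sSup {m : ℕ | ∃ T : Finset (Finset ℕ),
    (∀ A ∈ T, A.card = t) ∧ ¬ HasSunflower s T ∧ T.card = m}

/-! This is the delta-system method. Call `X ∈ F` good if it contains a `t`-set `D` such that every
`S` with `D ⊆ S ⊂ X` is the core of a sunflower in `F` with `2sk` petals.

Good sets: group them by `E = X \ D`. If the sets `D` over one `E` contained a sunflower with `s`
petals, its core could be padded inside `E` to size `t - 1`, and its petals extended one by one to
members of `F` with no new intersections (`hasSunflowerWithCoreCard_of_isKernel`). This is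
forbidden, so each of the `(k-t)`-sets `E` serves at most `φ(s,t)` good sets.

Bad sets: a positive proportion of them is rainbow and homogeneous, meaning that the colour sets of
kernels form one system `𝒥` for all members (`exists_homogeneous_subfamily`). This `𝒥` is closed
under intersection and has no member of size `t - 1`. If some `k-t-1` colours lie in no member of
`𝒥`, the points of those colours determine a set, giving a bound of lower order. Otherwise
`exists_card_eq_forall_singleton_of_union_closed` yields a good set, a contradiction. -/

/-! ### Union-closed systems with a forbidden size -/

/-- Hitting `T` exactly is what later produces a union of a prescribed size. Induction removes
points and members while it can. The configuration that resists has `|X| = |Y| + 1` and is excluded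
by the weighted double counting known from the de Bruijn–Erdős theorem. -/
theorem exists_card_add_card_filter_subset_eq {α β : Type*} [DecidableEq α] [DecidableEq β]
    (N : ℕ) : ∀ (X : Finset α) (Y : Finset β) (Z : β → Finset α) (T : ℕ),
      X.card + Y.card = N → Y.card ≤ T → T < X.card →
      ∃ R ⊆ X, R.card + (Y.filter fun y => Z y ⊆ R).card = T := by
  induction N using Nat.strong_induction_on with
  | _ N ih =>
  intro X Y Z T hN hYT hTX
  -- deleting a point `x` and contracting a set `A`
  have key : ∀ x ∈ X, ∀ A ⊆ X, x ∉ A →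
      ∀ Y' : Finset β, Y' = Y.filter (fun y => x ∉ Z y ∧ ¬ Z y ⊆ A) →
      Y'.card + (A.card + (Y.filter fun y => Z y ⊆ A).card) ≤ T →
      T < X.card - 1 + (Y.filter fun y => Z y ⊆ A).card →
      ∃ R ⊆ X, R.card + (Y.filter fun y => Z y ⊆ R).card = T := by
    intro x hx A hA hxA Y' hY' h1 h2
    have hc : ((X.erase x) \ A).card = X.card - 1 - A.card := by
      rw [Finset.card_sdiff_of_subset, Finset.card_erase_of_mem hx]
      exact fun z hz => Finset.mem_erase.2 ⟨fun h => hxA (h ▸ hz), hA hz⟩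
    have hAX : A.card ≤ X.card - 1 := by
      rw [← Finset.card_erase_of_mem hx]
      exact Finset.card_le_card
        fun z hz => Finset.mem_erase.2 ⟨fun h => hxA (h ▸ hz), hA hz⟩
    have hXpos : 0 < X.card := Finset.card_pos.2 ⟨x, hx⟩
    have hYle : Y'.card ≤ Y.card := by rw [hY']; exact Finset.card_filter_le _ _
    obtain ⟨R, hR, hRT⟩ := ih (((X.erase x) \ A).card + Y'.card) (by omega) ((X.erase x) \ A) Y'
      (fun y => Z y \ A) (T - (A.card + (Y.filter fun y => Z y ⊆ A).card)) rfl (by omega)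
      (by omega)
    have hRX : ∀ z ∈ R, z ≠ x ∧ z ∈ X ∧ z ∉ A := by
      intro z hz
      have := hR hz
      simp only [Finset.mem_sdiff, Finset.mem_erase] at this
      tauto
    refine ⟨R ∪ A, ?_, ?_⟩
    · intro z hz
      rcases Finset.mem_union.1 hz with h | h
      · exact (hRX z h).2.1
      · exact hA h
    · have hd : Disjoint R A := Finset.disjoint_left.2 fun z hz => (hRX z hz).2.2
      have hf : (Y.filter fun y => Z y ⊆ R ∪ A) =
          (Y'.filter fun y => Z y \ A ⊆ R) ∪ (Y.filter fun y => Z y ⊆ A) := by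
        ext y
        simp only [hY', Finset.mem_filter, Finset.mem_union, sdiff_le_iff,
          Finset.sup_eq_union]
        rw [Finset.union_comm R A]
        constructor
        · rintro ⟨h, h'⟩
          by_cases hyA : Z y ⊆ A
          · exact Or.inr ⟨h, hyA⟩
          · refine Or.inl ⟨⟨h, fun hxy => ?_, hyA⟩, h'⟩
            rcases Finset.mem_union.1 (h' hxy) with h3 | h3
            · exact hxA h3
            · exact (hRX x h3).1 rfl
        · rintro (⟨⟨h, -, -⟩, h'⟩ | ⟨h, h'⟩)
          · exact ⟨h, h'⟩
          · exact ⟨h, h'.trans Finset.subset_union_left⟩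
      have hd2 : Disjoint (Y'.filter fun y => Z y \ A ⊆ R) (Y.filter fun y => Z y ⊆ A) := by
        refine Finset.disjoint_left.2 fun y hy hy' => ?_
        rw [hY'] at hy
        simp only [Finset.mem_filter] at hy hy'
        exact hy.1.2.2 hy'.2
      rw [hf, Finset.card_union_of_disjoint hd, Finset.card_union_of_disjoint hd2]
      omega
  have hsplit : ∀ x : α, (Y.filter fun y => x ∉ Z y).card +
      (Y.filter fun y => x ∈ Z y).card = Y.card := by
    intro x
    have := Finset.card_filter_add_card_filter_not (s := Y) (fun y => x ∈ Z y)
    omega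
  -- a member that is not a proper subset of `X` never counts
  by_cases hbad : ∃ y ∈ Y, ¬ Z y ⊂ X
  · obtain ⟨y, hy, hyX⟩ := hbad
    have hYpos : 0 < Y.card := Finset.card_pos.2 ⟨y, hy⟩
    have hce := Finset.card_erase_of_mem hy
    obtain ⟨R, hR, hRT⟩ := ih (X.card + (Y.erase y).card) (by omega) X (Y.erase y) Z T rfl
      (by omega) hTX
    refine ⟨R, hR, ?_⟩
    rw [← hRT]
    congr 2
    ext w
    simp only [Finset.mem_filter, Finset.mem_erase]
    constructor
    · rintro ⟨h1, h2⟩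
      refine ⟨⟨fun h => ?_, h1⟩, h2⟩
      subst h
      have h3 : Z w = X := by
        by_contra h4
        exact hyX ((h2.trans hR).ssubset_of_ne h4)
      have h5 : X.card ≤ R.card := Finset.card_le_card (h3 ▸ h2)
      omega
    · rintro ⟨⟨-, h1⟩, h2⟩
      exact ⟨h1, h2⟩
  push Not at hbad
  -- contracting a single point
  by_cases hlt : Y.card < T
  · obtain ⟨x, hx⟩ := Finset.card_pos.1 (by omega : 0 < X.card)
    have hce := Finset.card_erase_of_mem hx
    obtain ⟨R, hR, hRT⟩ := ih ((X.erase x).card + Y.card) (by omega) (X.erase x) Y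
      (fun y => (Z y).erase x) (T - 1) rfl (by omega) (by omega)
    have hxR : x ∉ R := fun h => (Finset.mem_erase.1 (hR h)).1 rfl
    refine ⟨insert x R, Finset.insert_subset hx (hR.trans (Finset.erase_subset _ _)), ?_⟩
    rw [Finset.card_insert_of_notMem hxR]
    simp only [Finset.subset_insert_iff]
    omega
  have hTY : T = Y.card := by omega
  -- A trade: barring `x` from `R` discards all members through `x`, which pays for placing the
  -- whole of `Z y` in `R`.
  by_cases hlt2 : ∃ x ∈ X, ∃ y ∈ Y, x ∉ Z y ∧ (Z y).card ≤ (Y.filter fun y => x ∈ Z y).card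
  · obtain ⟨x, hx, y, hy, hxy, hle⟩ := hlt2
    refine key x hx (Z y) (hbad y hy).subset hxy _ rfl ?_ ?_
    · have h1 : (Y.filter fun w => x ∉ Z w ∧ ¬ Z w ⊆ Z y).card +
          (Y.filter fun w => Z w ⊆ Z y).card ≤ (Y.filter fun w => x ∉ Z w).card := by
        rw [← Finset.card_union_of_disjoint]
        · refine Finset.card_le_card fun w hw => ?_
          simp only [Finset.mem_union, Finset.mem_filter] at hw ⊢
          rcases hw with h | h
          · exact ⟨h.1, h.2.1⟩
          · exact ⟨h.1, fun h' => hxy (h.2 h')⟩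
        · refine Finset.disjoint_left.2 fun w hw hw' => ?_
          simp only [Finset.mem_filter] at hw hw'
          exact hw.2.2 hw'.2
      have := hsplit x
      omega
    · have : 0 < (Y.filter fun w => Z w ⊆ Z y).card :=
        Finset.card_pos.2 ⟨y, by simp [hy]⟩
      omega
  push Not at hlt2
  rcases Y.eq_empty_or_nonempty with rfl | hYne
  · exact ⟨∅, by simp, by simp [hTY]⟩
  by_cases hlt3 : T + 1 < X.card
  · obtain ⟨x, hx⟩ := Finset.card_pos.1 (by omega : 0 < X.card)
    refine key x hx ∅ (by simp) (by simp) _ rfl ?_ ?_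
    · rw [Finset.card_empty, zero_add, ← Finset.card_union_of_disjoint]
      · refine (Finset.card_le_card fun w hw => ?_).trans hYT
        simp only [Finset.mem_union, Finset.mem_filter] at hw
        tauto
      · refine Finset.disjoint_left.2 fun w hw hw' => ?_
        simp only [Finset.mem_filter] at hw hw'
        exact hw.2.2 hw'.2
    · omega
  -- Now `|X| = T + 1`, so removing a point common to all members leaves `T` points and no counted
  -- member.
  by_cases hfull : ∃ x ∈ X, ∀ y ∈ Y, x ∈ Z y
  · obtain ⟨x, hx, hxY⟩ := hfull
    refine ⟨X.erase x, Finset.erase_subset _ _, ?_⟩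
    rw [Finset.card_erase_of_mem hx, Finset.filter_false_of_mem, Finset.card_empty]
    · omega
    · exact fun y hy h => (Finset.mem_erase.1 (h (hxY y hy))).1 rfl
  push Not at hfull
  -- double counting of the pairs `x ∉ Z y`
  exfalso
  have hcard : (X.card : ℚ) ≤ Y.card := by
    calc (X.card : ℚ) = ∑ x ∈ X, ∑ y ∈ Y.filter (fun y => x ∉ Z y),
          (1 : ℚ) / ((Y.filter fun y => x ∉ Z y).card : ℚ) := by
          rw [Finset.card_eq_sum_ones, Nat.cast_sum]
          refine Finset.sum_congr rfl fun x hx => ?_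
          obtain ⟨y, hy, hxy⟩ := hfull x hx
          have : 0 < (Y.filter fun y => x ∉ Z y).card :=
            Finset.card_pos.2 ⟨y, by simp [hy, hxy]⟩
          rw [Finset.sum_const, nsmul_eq_mul]
          field_simp
          simp
      _ ≤ ∑ x ∈ X, ∑ y ∈ Y.filter (fun y => x ∉ Z y), (1 : ℚ) / ((X \ Z y).card : ℚ) := by
          refine Finset.sum_le_sum fun x hx => Finset.sum_le_sum fun y hy => ?_
          obtain ⟨hy, hxy⟩ := Finset.mem_filter.1 hy
          -- As no trade exists and `|X| = |Y| + 1`, the complement of `Z y` is no larger than the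
          -- number of members avoiding `x`.
          have h1 := hlt2 x hx y hy hxy
          have h2 := Finset.card_sdiff_of_subset (hbad y hy).subset
          have h3 := hsplit x
          have h4 : 0 < (X \ Z y).card := Finset.card_pos.2 ⟨x, by simp [hx, hxy]⟩
          exact one_div_le_one_div_of_le (by exact_mod_cast h4) (by exact_mod_cast (by omega))
      _ = ∑ y ∈ Y, ∑ x ∈ X \ Z y, (1 : ℚ) / ((X \ Z y).card : ℚ) := by
          refine Finset.sum_comm' fun x y => ?_
          simp only [Finset.mem_filter, Finset.mem_sdiff]
          tauto
      _ = Y.card := by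
          rw [Finset.card_eq_sum_ones, Nat.cast_sum]
          refine Finset.sum_congr rfl fun y hy => ?_
          have : 0 < (X \ Z y).card := by
            rw [Finset.card_pos, Finset.sdiff_nonempty]
            exact (hbad y hy).2
          rw [Finset.sum_const, nsmul_eq_mul]
          field_simp
          simp
  have : X.card ≤ Y.card := by exact_mod_cast hcard
  omega

/-- Take `I` maximal without nonempty members of `P`. Each `x ∉ I` then completes some `B x ⊆ I` to
a member, and unions of these members realise the forbidden size unless `|I| = t` and every `B x` is
empty; then `D = I`. -/
theorem exists_card_eq_forall_singleton_of_union_closed {κ : Type*} [Fintype κ] [DecidableEq κ]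
    (P : Finset κ → Prop) (t : ℕ) (hk : 2 * t + 1 ≤ Fintype.card κ)
    (hU : ∀ A B, P A → P B → P (A ∪ B))
    (hcov : ∀ T : Finset κ, T.card = t + 1 → ∃ A ⊆ T, A.Nonempty ∧ P A)
    (hno : ∀ A, P A → A.card ≠ Fintype.card κ - t + 1) :
    ∃ D : Finset κ, D.card = t ∧ ∀ x ∉ D, P {x} := by
  classical
  obtain ⟨I, hI, hmax⟩ := Finset.exists_max_image
    (Finset.univ.filter fun I : Finset κ => ∀ A ⊆ I, A.Nonempty → ¬ P A) Finset.card
    ⟨∅, by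
      simp only [Finset.mem_filter, Finset.mem_univ, true_and, Finset.subset_empty]
      rintro A rfl h
      exact absurd h (by simp)⟩
  simp only [Finset.mem_filter, Finset.mem_univ, true_and] at hI hmax
  have hIt : I.card ≤ t := by
    by_contra h
    obtain ⟨T, hT, hTc⟩ := Finset.exists_subset_card_eq (by omega : t + 1 ≤ I.card)
    obtain ⟨A, hA, hAne, hPA⟩ := hcov T hTc
    exact hI A (hA.trans hT) hAne hPA
  have hB : ∀ x, ∃ B : Finset κ, x ∉ I → B ⊆ I ∧ P (insert x B) := by
    intro x
    by_cases hx : x ∈ I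
    · exact ⟨∅, fun h => absurd hx h⟩
    · have h1 : ¬ ∀ A ⊆ insert x I, A.Nonempty → ¬ P A := by
        intro h
        have := hmax _ h
        rw [Finset.card_insert_of_notMem hx] at this
        omega
      push Not at h1
      obtain ⟨A, hA, hAne, hPA⟩ := h1
      have hxA : x ∈ A := by
        by_contra hxA
        exact hI A ((Finset.subset_insert_iff_of_notMem hxA).1 hA) hAne hPA
      refine ⟨A.erase x, fun _ => ⟨Finset.subset_insert_iff.1 hA, ?_⟩⟩
      rwa [Finset.insert_erase hxA]
  choose B hB using hB
  have hPS : ∀ S : Finset κ, S.Nonempty → (∀ x ∈ S, x ∉ I) →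
      P (S.biUnion fun x => insert x (B x)) := by
    intro S hS
    induction hS using Finset.Nonempty.cons_induction with
    | singleton a => intro h; simpa using (hB a (h a (by simp))).2
    | cons a s ha hs ih =>
      intro h
      rw [Finset.cons_eq_insert, Finset.biUnion_insert]
      exact hU _ _ (hB a (h a (by simp))).2 (ih fun x hx => h x (by simp [hx]))
  set X : Finset κ := Iᶜ with hX
  have hmemX : ∀ x, x ∈ X ↔ x ∉ I := fun x => by simp [hX]
  have hcX : X.card + I.card = Fintype.card κ := by
    rw [hX, Finset.card_compl]
    have := Finset.card_le_univ I
    omega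
  let Z : κ → Finset κ := fun y => X.filter fun x => y ∈ B x
  -- The union over `x ∈ X \ R` misses exactly `R` and those `y ∈ I` with `Z y ⊆ R`.
  have main : ∀ R ⊆ X, 1 ≤ t → R.card + (I.filter fun y => Z y ⊆ R).card = t - 1 → False := by
    intro R hR ht hRT
    have hlt : R.card < X.card := by omega
    have hne : (X \ R).Nonempty := by
      rw [Finset.sdiff_nonempty]
      exact fun h => absurd (Finset.card_le_card h) (by omega)
    have hSI : ∀ x ∈ X \ R, x ∉ I := fun x hx => (hmemX x).1 (Finset.mem_sdiff.1 hx).1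
    refine hno _ (hPS _ hne hSI) ?_
    have heq : ((X \ R).biUnion fun x => insert x (B x)) =
        (X \ R) ∪ I.filter fun y => ¬ Z y ⊆ R := by
      ext y
      simp only [Finset.mem_biUnion, Finset.mem_insert, Finset.mem_union, Finset.mem_filter]
      constructor
      · rintro ⟨x, hx, rfl | hy⟩
        · exact Or.inl hx
        · refine Or.inr ⟨(hB x (hSI x hx)).1 hy, fun h => (Finset.mem_sdiff.1 hx).2 (h ?_)⟩
          simp only [Z, Finset.mem_filter]
          exact ⟨(Finset.mem_sdiff.1 hx).1, hy⟩
      · rintro (h | ⟨-, h⟩)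
        · exact ⟨y, h, Or.inl rfl⟩
        · obtain ⟨x, hx, hxR⟩ := Finset.not_subset.1 h
          simp only [Z, Finset.mem_filter] at hx
          exact ⟨x, Finset.mem_sdiff.2 ⟨hx.1, hxR⟩, Or.inr hx.2⟩
    rw [heq, Finset.card_union_of_disjoint, Finset.card_sdiff_of_subset hR]
    · have := Finset.card_filter_add_card_filter_not (s := I) (fun y => Z y ⊆ R)
      omega
    · exact Finset.disjoint_left.2 fun x hx hx' => hSI x hx (Finset.mem_filter.1 hx').1
  rcases hIt.lt_or_eq with hlt | heq
  · obtain ⟨R, hR, hRT⟩ := exists_card_add_card_filter_subset_eq _ X I Z (t - 1) rfl (by omega)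
      (by omega)
    exact (main R hR (by omega) hRT).elim
  · by_cases hall : ∀ x ∈ X, B x = ∅
    · refine ⟨I, heq, fun x hx => ?_⟩
      have := (hB x hx).2
      rwa [hall x ((hmemX x).2 hx)] at this
    push Not at hall
    obtain ⟨x, hx, hne⟩ := hall
    obtain ⟨y, hy⟩ := hne
    have hyI : y ∈ I := (hB x ((hmemX x).1 hx)).1 hy
    -- With `|I| = t` there is one member too many for the target `t - 1`. Keeping `x` out of `R`
    -- disposes of every `y ∈ B x`.
    have hlt : (I.filter fun y => x ∉ Z y).card < I.card := by
      refine Finset.card_lt_card (Finset.filter_ssubset.2 ⟨y, hyI, ?_⟩)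
      simp [Z, hx, hy]
    have hce := Finset.card_erase_of_mem hx
    obtain ⟨R, hR, hRT⟩ := exists_card_add_card_filter_subset_eq _ (X.erase x)
      (I.filter fun y => x ∉ Z y) Z (t - 1) rfl (by omega) (by omega)
    have hxR : x ∉ R := fun h => (Finset.mem_erase.1 (hR h)).1 rfl
    refine (main R (hR.trans (Finset.erase_subset _ _)) (by omega) ?_).elim
    rw [← hRT, Finset.filter_filter]
    congr 2
    ext y
    simp only [Finset.mem_filter]
    exact ⟨fun h => ⟨h.1, fun h' => hxR (h.2 h'), h.2⟩, fun h => ⟨h.1, h.2.2⟩⟩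

/-! ### Rainbow subfamilies and kernels -/

/-- Averaging over all colourings: fixing one bijection on `A` and colouring the rest freely shows
that `A` is rainbow in at least a `k ^ (-k)` share of them. -/
theorem exists_coloring_card_le {α : Type*} [Fintype α] [DecidableEq α] (k : ℕ) (hk : 0 < k)
    (F : Finset (Finset α)) (hF : ∀ A ∈ F, A.card = k) :
    ∃ χ : α → Fin k, ∃ G ⊆ F, F.card ≤ k ^ k * G.card ∧ ∀ A ∈ G, Set.InjOn χ A := by
  classical
  by_contra! hcon
  have hsum : ∑ χ : α → Fin k, k ^ k * (F.filter fun A : Finset α => Set.InjOn χ A).card <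
      ∑ _χ : α → Fin k, F.card := by
    refine Finset.sum_lt_sum_of_nonempty ⟨fun _ => ⟨0, hk⟩, Finset.mem_univ _⟩ fun χ _ => ?_
    by_contra! h
    obtain ⟨A, hA, hA'⟩ := hcon χ _ (Finset.filter_subset _ _) h
    exact hA' (Finset.mem_filter.1 hA).2
  have hcount : ∀ A ∈ F, k ^ (Fintype.card α) ≤
      k ^ k * (Finset.univ.filter fun χ : α → Fin k => Set.InjOn χ A).card := by
    intro A hA
    have hAk := hF A hA
    let e : A ≃ Fin k := Finset.equivFinOfCardEq hAk
    have h1 : Fintype.card ({x // x ∉ A} → Fin k) ≤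
        (Finset.univ.filter fun χ : α → Fin k => Set.InjOn χ A).card := by
      rw [← Finset.card_univ]
      refine Finset.card_le_card_of_injOn
        (fun g x => if h : x ∈ A then e ⟨x, h⟩ else g ⟨x, h⟩) ?_ ?_
      · intro g _
        simp only [Finset.coe_filter, Finset.mem_univ, true_and, Set.mem_ofPred_eq]
        intro x hx y hy hxy
        have hx' : x ∈ A := hx
        have hy' : y ∈ A := hy
        simpa [hx', hy'] using hxy
      · intro g _ g' _ h
        funext ⟨x, hx⟩
        simpa [hx] using congrFun h x
    have h2 : Fintype.card ({x // x ∉ A} → Fin k) = k ^ (Fintype.card α - k) := by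
      simp [Fintype.card_subtype_compl, hAk]
    have h3 : k ≤ Fintype.card α := hAk ▸ Finset.card_le_univ A
    calc k ^ (Fintype.card α) = k ^ k * k ^ (Fintype.card α - k) := by
          rw [← pow_add, Nat.add_sub_cancel' h3]
      _ ≤ _ := Nat.mul_le_mul_left _ (h2 ▸ h1)
  have hdc : ∑ χ : α → Fin k, (F.filter fun A : Finset α => Set.InjOn χ A).card =
      ∑ A ∈ F, (Finset.univ.filter fun χ : α → Fin k => Set.InjOn χ A).card := by
    simp only [Finset.card_filter]
    exact Finset.sum_comm
  have h4 := Finset.sum_le_sum hcount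
  rw [← Finset.mul_sum, hdc, Finset.mul_sum] at hsum
  simp only [Finset.sum_const, smul_eq_mul, Finset.card_univ, Fintype.card_fun,
    Fintype.card_fin] at hsum h4
  rw [mul_comm] at h4
  exact absurd (h4.trans_lt hsum) (lt_irrefl _)

/-- `A` is the core of a sunflower with `m` petals in `G`. -/
def IsKernel {α : Type*} [DecidableEq α] (G : Finset (Finset α)) (m : ℕ) (A : Finset α) : Prop :=
  ∃ S ⊆ G, S.card = m ∧ (∀ B ∈ S, A ⊆ B) ∧ ∀ B ∈ S, ∀ B' ∈ S, B ≠ B' → B ∩ B' = A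

theorem IsKernel.mono {α : Type*} [DecidableEq α] {G G' : Finset (Finset α)} {m : ℕ}
    {A : Finset α} (h : IsKernel G m A) (hG : G ⊆ G') : IsKernel G' m A := by
  obtain ⟨S, hS, h⟩ := h
  exact ⟨S, hS.trans hG, h⟩

theorem IsKernel.of_le {α : Type*} [DecidableEq α] {G : Finset (Finset α)} {m m' : ℕ}
    {A : Finset α} (h : IsKernel G m A) (hm : m' ≤ m) : IsKernel G m' A := by
  obtain ⟨S, hS, hc, h1, h2⟩ := h
  obtain ⟨S', hS', hc'⟩ := Finset.exists_subset_card_eq (hc ▸ hm)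
  exact ⟨S', hS'.trans hS, hc', fun B hB => h1 B (hS' hB),
    fun B hB B' hB' => h2 B (hS' hB) B' (hS' hB')⟩

theorem IsKernel.hasSunflowerWithCoreCard {α : Type*} [DecidableEq α] {G : Finset (Finset α)}
    {m : ℕ} {A : Finset α} (h : IsKernel G m A) (hm : 2 ≤ m) :
    HasSunflowerWithCoreCard m A.card G := by
  obtain ⟨S, hS, hc, h1, h2⟩ := h
  refine ⟨S, hS, hc, A, rfl, fun x => ⟨fun hx B hB => h1 B hB hx, fun hx => ?_⟩, h2⟩
  obtain ⟨B, hB, B', hB', hne⟩ := Finset.one_lt_card.1 (by omega : 1 < S.card)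
  rw [← h2 B hB B' hB' hne]
  exact Finset.mem_inter.2 ⟨hx B hB, hx B' hB'⟩

/-- Outside `A` the petals are disjoint, so fewer than `m` points cannot meet all of them. -/
theorem IsKernel.exists_disjoint {α : Type*} [DecidableEq α] {G : Finset (Finset α)}
    {m : ℕ} {A : Finset α} (h : IsKernel G m A) (Q : Finset α) (hQ : Q.card < m) :
    ∃ B ∈ G, A ⊆ B ∧ B ∩ Q ⊆ A := by
  obtain ⟨S, hS, hc, h1, h2⟩ := h
  by_contra! hcon
  have h3 : ∀ B ∈ S, ∃ x ∈ Q, x ∈ B ∧ x ∉ A := by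
    intro B hB
    obtain ⟨x, hx, hxA⟩ := Finset.not_subset.1 (hcon B (hS hB) (h1 B hB))
    exact ⟨x, (Finset.mem_inter.1 hx).2, (Finset.mem_inter.1 hx).1, hxA⟩
  obtain ⟨B₀, hB₀⟩ := Finset.card_pos.1 (by omega : 0 < S.card)
  obtain ⟨x₀, -⟩ := h3 B₀ hB₀
  have : Nonempty α := ⟨x₀⟩
  choose! f hf using h3
  have : S.card ≤ Q.card := by
    refine Finset.card_le_card_of_injOn f (fun B hB => (hf B hB).1) fun B hB B' hB' hBB => ?_
    by_contra hne
    refine (hf B hB).2.2 (h2 B hB B' hB' hne ▸ Finset.mem_inter.2 ⟨(hf B hB).2.1, ?_⟩)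
    rw [hBB]
    exact (hf B' hB').2.1
  omega

/-! ### Homogeneous subfamilies -/

/-- While some `p J A` is not a kernel of the current family, its whole fibre under `p J` moves to
`B J`. Later removals come from subfamilies of that family, so the fibre collected in `B J` still
has no such sunflower. -/
theorem exists_kernel_deletion {α ι : Type*} [DecidableEq α] [DecidableEq ι] (m : ℕ) (hm : 0 < m)
    (p : ι → Finset α → Finset α) (𝒜 : Finset ι) (F : Finset (Finset α)) :
    ∃ G ⊆ F, ∃ B : ι → Finset (Finset α), (∀ J, B J ⊆ F) ∧ F ⊆ G ∪ 𝒜.biUnion B ∧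
      (∀ J ∈ 𝒜, ∀ A ∈ G, IsKernel G m (p J A)) ∧
      ∀ J A, ¬ IsKernel ((B J).filter fun X => p J X = A) m A := by
  induction F using Finset.strongInduction with
  | H F ih =>
  by_cases hgood : ∀ J ∈ 𝒜, ∀ A ∈ F, IsKernel F m (p J A)
  · refine ⟨F, subset_rfl, fun _ => ∅, by simp, by simp, hgood, ?_⟩
    rintro J A ⟨S, hS, hc, -⟩
    have := Finset.card_le_card hS
    rw [Finset.filter_empty, Finset.card_empty] at this
    omega
  push Not at hgood
  obtain ⟨J, hJ, A, hA, hker⟩ := hgood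
  set H := F.filter fun X => p J X = p J A with hH
  obtain ⟨G, hG, B, hB, hcov, hk, hthin⟩ := ih (F \ H)
    (Finset.sdiff_ssubset (Finset.filter_subset _ _) ⟨A, by simp [hH, hA]⟩)
  have hsub : F \ H ⊆ F := Finset.sdiff_subset
  refine ⟨G, hG.trans hsub, Function.update B J (B J ∪ H), ?_, ?_, hk, ?_⟩
  · intro J'
    rcases eq_or_ne J' J with rfl | h
    · rw [Function.update_self]
      exact Finset.union_subset ((hB _).trans hsub) (Finset.filter_subset _ _)
    · rw [Function.update_of_ne h]
      exact (hB _).trans hsub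
  · intro X hX
    by_cases hXH : X ∈ H
    · refine Finset.mem_union_right _ (Finset.mem_biUnion.2 ⟨J, hJ, ?_⟩)
      rw [Function.update_self]
      exact Finset.mem_union_right _ hXH
    · rcases Finset.mem_union.1 (hcov (Finset.mem_sdiff.2 ⟨hX, hXH⟩)) with h | h
      · exact Finset.mem_union_left _ h
      · obtain ⟨J', hJ', hXJ⟩ := Finset.mem_biUnion.1 h
        refine Finset.mem_union_right _ (Finset.mem_biUnion.2 ⟨J', hJ', ?_⟩)
        rcases eq_or_ne J' J with rfl | h
        · rw [Function.update_self]
          exact Finset.mem_union_left _ hXJ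
        · rwa [Function.update_of_ne h]
  · intro J' C
    rcases eq_or_ne J' J with rfl | h
    · rw [Function.update_self]
      intro hC
      rcases eq_or_ne C (p J' A) with rfl | hne
      · refine hker (hC.mono ?_)
        exact (Finset.filter_subset _ _).trans
          (Finset.union_subset ((hB _).trans hsub) (Finset.filter_subset _ _))
      · refine hthin J' C (hC.mono fun X hX => ?_)
        obtain ⟨h1, h2⟩ := Finset.mem_filter.1 hX
        refine Finset.mem_filter.2 ⟨(Finset.mem_union.1 h1).resolve_right fun h3 => ?_, h2⟩
        exact hne (h2.symm.trans (Finset.mem_filter.1 h3).2)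
    · rw [Function.update_of_ne h]
      exact hthin J' C

/-- A maximal sunflower with core `C` has fewer than `m` petals, and every member of `H` meets their
union outside `C`; pigeonhole on at most `m * k` points. -/
theorem exists_popular_point {α : Type*} [DecidableEq α] (m k : ℕ) (C : Finset α)
    (H : Finset (Finset α)) (hne : H.Nonempty) (hk : ∀ X ∈ H, X.card = k)
    (hC : ∀ X ∈ H, C ⊂ X) (hker : ¬ IsKernel H m C) :
    ∃ x ∉ C, H.card ≤ m * k * (H.filter fun X => x ∈ X).card := by
  classical
  obtain ⟨S, hS, hmax⟩ := Finset.exists_max_image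
    (H.powerset.filter fun S => ∀ B ∈ S, ∀ B' ∈ S, B ≠ B' → B ∩ B' = C) Finset.card
    ⟨∅, by simp⟩
  simp only [Finset.mem_filter, Finset.mem_powerset] at hS hmax
  have hSm : S.card < m := by
    by_contra! h
    exact hker (IsKernel.of_le ⟨S, hS.1, rfl, fun B hB => (hC B (hS.1 hB)).subset, hS.2⟩ h)
  set U := S.biUnion id \ C with hU
  have hUc : U.card ≤ m * k := by
    calc U.card ≤ (S.biUnion id).card := Finset.card_le_card Finset.sdiff_subset
      _ ≤ S.card * k := Finset.card_biUnion_le_card_mul _ _ _ fun X hX => (hk X (hS.1 hX)).le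
      _ ≤ m * k := Nat.mul_le_mul_right _ hSm.le
  have hmeet : ∀ X ∈ H, ∃ x ∈ U, x ∈ X := by
    intro X hX
    by_cases hXS : X ∈ S
    · obtain ⟨x, hx, hxC⟩ := Finset.exists_of_ssubset (hC X hX)
      exact ⟨x, Finset.mem_sdiff.2 ⟨Finset.mem_biUnion.2 ⟨X, hXS, hx⟩, hxC⟩, hx⟩
    · by_contra! hcon
      have hXB : ∀ B ∈ S, X ∩ B = C := by
        intro B hB
        refine Finset.Subset.antisymm (fun x hx => ?_)
          (Finset.subset_inter (hC X hX).subset (hC B (hS.1 hB)).subset)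
        by_contra hxC
        obtain ⟨h1, h2⟩ := Finset.mem_inter.1 hx
        exact hcon x (Finset.mem_sdiff.2 ⟨Finset.mem_biUnion.2 ⟨B, hB, h2⟩, hxC⟩) h1
      have := hmax (insert X S) ⟨Finset.insert_subset hX hS.1, ?_⟩
      · rw [Finset.card_insert_of_notMem hXS] at this
        omega
      · intro B hB B' hB' hBB
        rcases Finset.mem_insert.1 hB with rfl | h1 <;> rcases Finset.mem_insert.1 hB' with rfl | h2
        · exact absurd rfl hBB
        · exact hXB _ h2
        · rw [Finset.inter_comm]
          exact hXB _ h1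
        · exact hS.2 _ h1 _ h2 hBB
  have hUne : U.Nonempty := by
    obtain ⟨X, hX⟩ := hne
    obtain ⟨x, hx, -⟩ := hmeet X hX
    exact ⟨x, hx⟩
  by_contra! hcon
  have h1 : H.card ≤ ∑ x ∈ U, (H.filter fun X => x ∈ X).card := by
    refine (Finset.card_le_card fun X hX => ?_).trans Finset.card_biUnion_le
    obtain ⟨x, hx, hxX⟩ := hmeet X hX
    exact Finset.mem_biUnion.2 ⟨x, hx, Finset.mem_filter.2 ⟨hX, hxX⟩⟩
  have h2 : ∑ x ∈ U, m * k * (H.filter fun X => x ∈ X).card < ∑ _x ∈ U, H.card :=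
    Finset.sum_lt_sum_of_nonempty hUne fun x hx => hcon x (Finset.mem_sdiff.1 hx).2
  rw [← Finset.mul_sum, Finset.sum_const, smul_eq_mul] at h2
  have h3 := Nat.mul_le_mul_left (m * k) h1
  have h4 := Nat.mul_le_mul_right H.card hUc
  omega

/-- In each fibre only the sets through its popular point are kept; that point lies in all their
intersections but not in the common trace. -/
theorem exists_subfamily_inter_ne {α : Type*} [DecidableEq α] (m k : ℕ)
    (p : Finset α → Finset α) (B : Finset (Finset α)) (hk : ∀ X ∈ B, X.card = k)
    (hp : ∀ X ∈ B, p X ⊂ X) (hthin : ∀ C, ¬ IsKernel (B.filter fun X => p X = C) m C) :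
    ∃ B' ⊆ B, B.card ≤ m * k * B'.card ∧
      ∀ X ∈ B', ∀ Y ∈ B', p X = p Y → X ∩ Y ≠ p X := by
  have h : ∀ C, C ∈ B.image p → ∃ x ∉ C, (B.filter fun X => p X = C).card ≤
      m * k * ((B.filter fun X => p X = C).filter fun X => x ∈ X).card := by
    intro C hC
    obtain ⟨X, hX, rfl⟩ := Finset.mem_image.1 hC
    refine exists_popular_point m k _ _ ⟨X, by simp [hX]⟩
      (fun Y hY => hk Y (Finset.mem_filter.1 hY).1) (fun Y hY => ?_) (hthin _)
    obtain ⟨h1, h2⟩ := Finset.mem_filter.1 hY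
    exact h2 ▸ hp Y h1
  rcases B.eq_empty_or_nonempty with rfl | ⟨X₀, hX₀⟩
  · exact ⟨∅, subset_rfl, by simp, by simp⟩
  obtain ⟨x₀, -⟩ := h _ (Finset.mem_image_of_mem p hX₀)
  have : Nonempty α := ⟨x₀⟩
  choose! x hx hcard using h
  refine ⟨B.filter fun X => x (p X) ∈ X, Finset.filter_subset _ _, ?_, ?_⟩
  · rw [Finset.card_eq_sum_card_image p B,
      Finset.card_eq_sum_card_fiberwise (f := p) (t := B.image p)
        (s := B.filter fun X => x (p X) ∈ X), Finset.mul_sum]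
    · refine Finset.sum_le_sum fun C hC => (hcard C hC).trans (Nat.mul_le_mul_left _ ?_)
      refine Finset.card_le_card fun X hX => ?_
      simp only [Finset.mem_filter] at hX ⊢
      obtain ⟨⟨h1, rfl⟩, h2⟩ := hX
      exact ⟨⟨h1, h2⟩, rfl⟩
    · intro X hX
      exact Finset.mem_coe.2 (Finset.mem_image_of_mem p (Finset.mem_filter.1 hX).1)
  · intro X hX Y hY hXY heq
    obtain ⟨h1, h2⟩ := Finset.mem_filter.1 hX
    obtain ⟨h3, h4⟩ := Finset.mem_filter.1 hY
    rw [← hXY] at h4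
    have h5 : x (p X) ∈ X ∩ Y := Finset.mem_inter.2 ⟨h2, h4⟩
    rw [heq] at h5
    exact hx (p X) (Finset.mem_image_of_mem p h1) h5

/-- After deletion one of at most `M` pieces carries a `1/M` share. If it is `G`, all remaining
types are kernels; if it is some `B J`, type `J` is made dead at a cost `m * k` and the process
restarts with fewer types. -/
theorem exists_homogeneous_subfamily {α ι : Type*} [DecidableEq α] [DecidableEq ι]
    (m k M : ℕ) (hm : 0 < m) (hk0 : 0 < k) (p : ι → Finset α → Finset α) (𝒜 : Finset ι)
    (hM : 𝒜.card + 1 ≤ M) (F : Finset (Finset α)) (hne : F.Nonempty) (hk : ∀ X ∈ F, X.card = k)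
    (hp : ∀ J ∈ 𝒜, ∀ X ∈ F, p J X ⊂ X)
    (hdead : ∀ J ∉ 𝒜, ∀ X ∈ F, ∀ Y ∈ F, X ≠ Y → p J X = p J Y → X ∩ Y ≠ p J X) :
    ∃ G ⊆ F, ∃ 𝒥 ⊆ 𝒜, F.card ≤ (M * (m * k)) ^ (𝒜.card + 1) * G.card ∧
      (∀ J ∈ 𝒥, ∀ X ∈ G, IsKernel G m (p J X)) ∧
      ∀ J ∉ 𝒥, ∀ X ∈ G, ∀ Y ∈ G, X ≠ Y → p J X = p J Y → X ∩ Y ≠ p J X := by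
  have hmk : 0 < m * k := Nat.mul_pos hm hk0
  induction hc : 𝒜.card using Nat.strong_induction_on generalizing 𝒜 F with
  | _ c ih =>
  obtain ⟨G, hG, B, hB, hcov, hker, hthin⟩ := exists_kernel_deletion m hm p 𝒜 F
  have hβ : M ≤ (M * (m * k)) ^ (c + 1) :=
    (Nat.le_mul_of_pos_right M hmk).trans (Nat.le_self_pow (by omega) _)
  by_cases hGF : F.card ≤ M * G.card
  · exact ⟨G, hG, 𝒜, subset_rfl, hGF.trans (Nat.mul_le_mul_right _ hβ), hker,
      fun J hJ X hX Y hY => hdead J hJ X (hG hX) Y (hG hY)⟩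
  have hJ : ∃ J ∈ 𝒜, F.card ≤ M * (B J).card := by
    by_contra! hcon
    have h1 : F.card ≤ G.card + ∑ J ∈ 𝒜, (B J).card :=
      (Finset.card_le_card hcov).trans ((Finset.card_union_le _ _).trans
        (Nat.add_le_add_left Finset.card_biUnion_le _))
    have h2 : ∑ J ∈ 𝒜, M * (B J).card ≤ ∑ _J ∈ 𝒜, F.card :=
      Finset.sum_le_sum fun J hJ => (hcon J hJ).le
    rw [← Finset.mul_sum, Finset.sum_const, smul_eq_mul] at h2
    have h3 := Nat.mul_le_mul_left M h1
    have h4 := Nat.mul_le_mul_right F.card hM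
    rw [Nat.mul_add] at h3
    rw [Nat.add_mul] at h4
    omega
  obtain ⟨J, hJ, hFB⟩ := hJ
  obtain ⟨B', hB', hcard, hne'⟩ := exists_subfamily_inter_ne m k (p J) (B J)
    (fun X hX => hk X (hB J hX)) (fun X hX => hp J hJ X (hB J hX)) (hthin J)
  have hB'F : B' ⊆ F := hB'.trans (hB J)
  have hFB' : F.card ≤ M * (m * k) * B'.card := by
    rw [mul_assoc]
    exact hFB.trans (Nat.mul_le_mul_left M hcard)
  have hB'ne : B'.Nonempty := by
    rw [Finset.nonempty_iff_ne_empty]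
    rintro rfl
    rw [Finset.card_empty, Nat.mul_zero, Nat.le_zero, Finset.card_eq_zero] at hFB'
    exact hne.ne_empty hFB'
  have hce := Finset.card_erase_of_mem hJ
  have hpos : 0 < 𝒜.card := Finset.card_pos.2 ⟨J, hJ⟩
  obtain ⟨G', hG', 𝒥, h𝒥, hc', hk', hd'⟩ := ih (𝒜.erase J).card (by omega) (𝒜.erase J) (by omega)
    B' hB'ne (fun X hX => hk X (hB'F hX))
    (fun J' hJ' X hX => hp J' (Finset.mem_of_mem_erase hJ') X (hB'F hX))
    (fun J' hJ' X hX Y hY hXY hpp => by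
      rcases eq_or_ne J' J with rfl | h
      · exact hne' X hX Y hY hpp
      · exact hdead J' (fun h' => hJ' (Finset.mem_erase.2 ⟨h, h'⟩)) X (hB'F hX) Y (hB'F hY)
          hXY hpp) rfl
  refine ⟨G', hG'.trans hB'F, 𝒥, h𝒥.trans (Finset.erase_subset _ _), ?_, hk', hd'⟩
  have h5 : (𝒜.erase J).card + 1 = c := by omega
  rw [h5] at hc'
  calc F.card ≤ M * (m * k) * B'.card := hFB'
    _ ≤ M * (m * k) * ((M * (m * k)) ^ c * G'.card) := Nat.mul_le_mul_left _ hc'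
    _ = (M * (m * k)) ^ (c + 1) * G'.card := by ring

/-! ### Kernel types of a rainbow homogeneous family -/

theorem image_filter_of_rainbow {α : Type*} [DecidableEq α] {k : ℕ} {χ : α → Fin k}
    {X : Finset α} (hχ : Set.InjOn χ X) (hX : X.card = k) (J : Finset (Fin k)) :
    (X.filter fun x => χ x ∈ J).image χ = J := by
  have h : X.image χ = Finset.univ := by
    rw [← Finset.card_eq_iff_eq_univ, Finset.card_image_of_injOn hχ, hX, Fintype.card_fin]
  ext c
  simp only [Finset.mem_image, Finset.mem_filter]
  constructor
  · rintro ⟨x, ⟨-, h⟩, rfl⟩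
    exact h
  · intro hc
    obtain ⟨x, hx, rfl⟩ := Finset.mem_image.1 (h ▸ Finset.mem_univ c)
    exact ⟨x, ⟨hx, hc⟩, rfl⟩

theorem card_filter_of_rainbow {α : Type*} [DecidableEq α] {k : ℕ} {χ : α → Fin k}
    {X : Finset α} (hχ : Set.InjOn χ X) (hX : X.card = k) (J : Finset (Fin k)) :
    (X.filter fun x => χ x ∈ J).card = J.card := by
  rw [← Finset.card_image_of_injOn (hχ.mono (Finset.filter_subset _ _)),
    image_filter_of_rainbow hχ hX]

theorem filter_eq_of_image_eq {α : Type*} [DecidableEq α] {k : ℕ} {χ : α → Fin k}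
    {X S : Finset α} (hχ : Set.InjOn χ X) (hS : S ⊆ X) :
    (X.filter fun x => χ x ∈ S.image χ) = S := by
  ext x
  simp only [Finset.mem_filter, Finset.mem_image]
  constructor
  · rintro ⟨hx, y, hy, hxy⟩
    rwa [← hχ (hS hy) hx hxy]
  · exact fun hx => ⟨hS hx, x, hx, rfl⟩

theorem card_le_or_exists_kernel_system {α : Type*} [Fintype α] [DecidableEq α] (m k t : ℕ)
    (ht : 1 ≤ t) (hkt : 2 * t + 1 ≤ k) (hm : k < m) (F : Finset (Finset α)) (hne : F.Nonempty)
    (hk : ∀ X ∈ F, X.card = k) (hF : ∀ A : Finset α, A.card = t - 1 → ¬ IsKernel F m A) :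
    F.card ≤ k ^ k * (2 ^ k * (m * k)) ^ (2 ^ k) * (Fintype.card α).choose (k - t - 1) ∨
      ∃ X ∈ F, ∃ D ⊆ X, D.card = t ∧ ∀ S, D ⊆ S → S ⊂ X → IsKernel F m S := by
  classical
  obtain ⟨χ, G₀, hG₀, hcard₀, hχ₀⟩ := exists_coloring_card_le k (by omega) F hk
  have hne₀ : G₀.Nonempty := by
    rw [Finset.nonempty_iff_ne_empty]
    rintro rfl
    rw [Finset.card_empty, Nat.mul_zero, Nat.le_zero, Finset.card_eq_zero] at hcard₀
    exact hne.ne_empty hcard₀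
  let p : Finset (Fin k) → Finset α → Finset α := fun J X => X.filter fun x => χ x ∈ J
  have hpsub : ∀ J X, p J X ⊆ X := fun J X => Finset.filter_subset _ _
  have hcardJ : ∀ J : Finset (Fin k), J ≠ Finset.univ → J.card < k := fun J hJ => by
    simpa using Finset.card_lt_univ_of_notMem
      (Finset.eq_univ_iff_forall.not.1 hJ |> not_forall.1).choose_spec
  have hpssub : ∀ J : Finset (Fin k), J ≠ Finset.univ → ∀ X ∈ G₀, p J X ⊂ X := by
    intro J hJ X hX
    refine (hpsub J X).ssubset_of_ne fun h => ?_
    have h1 := card_filter_of_rainbow (hχ₀ X hX) (hk X (hG₀ hX)) J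
    have h2 := hcardJ J hJ
    have h3 : (p J X).card = k := by rw [h, hk X (hG₀ hX)]
    simp only [p] at h3
    omega
  have hA : (Finset.univ.erase (Finset.univ : Finset (Fin k))).card + 1 = 2 ^ k := by
    rw [Finset.card_erase_add_one (Finset.mem_univ _)]
    simp
  obtain ⟨G, hG, 𝒥, h𝒥, hcard, hker, hdead⟩ := exists_homogeneous_subfamily m k (2 ^ k) (by omega)
    (by omega) p (Finset.univ.erase Finset.univ) hA.le G₀ hne₀ (fun X hX => hk X (hG₀ hX))
    (fun J hJ => hpssub J (Finset.ne_of_mem_erase hJ))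
    -- The full colour set is dead from the outset: its trace on `X` is `X` itself.
    (fun J hJ X _ Y _ hXY hp => by
      have hJ' : J = Finset.univ := by simpa using hJ
      subst hJ'
      simp [p] at hp
      exact absurd hp hXY)
  rw [hA] at hcard
  have hGF : G ⊆ F := hG.trans hG₀
  have hχ : ∀ X ∈ G, Set.InjOn χ X := fun X hX => hχ₀ X (hG hX)
  have hkG : ∀ X ∈ G, X.card = k := fun X hX => hk X (hGF hX)
  have hGne : G.Nonempty := by
    rw [Finset.nonempty_iff_ne_empty]
    rintro rfl
    rw [Finset.card_empty, Nat.mul_zero, Nat.le_zero, Finset.card_eq_zero] at hcard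
    exact hne₀.ne_empty hcard
  obtain ⟨X₀, hX₀⟩ := hGne
  have hproper : ∀ J ∈ 𝒥, J ≠ Finset.univ := fun J hJ => Finset.ne_of_mem_erase (h𝒥 hJ)
  have hpeq : ∀ X ∈ G, ∀ Y ∈ G, ∀ J J' : Finset (Fin k), p J X ⊆ Y → J' ⊆ J →
      p J' X = p J' Y := by
    intro X hX Y hY J J' hJ hJJ
    refine Finset.eq_of_subset_of_card_le (fun x hx => ?_) ?_
    · obtain ⟨h1, h2⟩ := Finset.mem_filter.1 hx
      exact Finset.mem_filter.2 ⟨hJ (Finset.mem_filter.2 ⟨h1, hJJ h2⟩), h2⟩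
    · simp only [p]
      rw [card_filter_of_rainbow (hχ X hX) (hkG X hX), card_filter_of_rainbow (hχ Y hY) (hkG Y hY)]
  -- Since `m > k`, there is `Y` extending `p J X₀` and otherwise missing `X₀`, then `Y'` extending
  -- `p J' X₀` and otherwise missing `Y`. They meet exactly in `p (J ∩ J') X₀`, so that type is not
  -- dead.
  have hinter : ∀ J ∈ 𝒥, ∀ J' ∈ 𝒥, J ∩ J' ∈ 𝒥 := by
    intro J hJ J' hJ'
    by_contra hJJ
    obtain ⟨Y, hY, hJY, hYX⟩ := (hker J hJ X₀ hX₀).exists_disjoint X₀ (by rw [hkG _ hX₀]; omega)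
    obtain ⟨Y', hY', hJY', hYY⟩ := (hker J' hJ' X₀ hX₀).exists_disjoint Y
      (by rw [hkG _ hY]; omega)
    have h1 := hpeq X₀ hX₀ Y hY J (J ∩ J') hJY Finset.inter_subset_left
    have h2 := hpeq X₀ hX₀ Y' hY' J' (J ∩ J') hJY' Finset.inter_subset_right
    have h3 : Y ∩ Y' = p (J ∩ J') X₀ := by
      ext x
      simp only [Finset.mem_inter, p, Finset.mem_filter]
      constructor
      · rintro ⟨hx, hx'⟩
        have h4 := Finset.mem_filter.1 (hYY (Finset.mem_inter.2 ⟨hx', hx⟩))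
        have h5 := Finset.mem_filter.1 (hYX (Finset.mem_inter.2 ⟨hx, h4.1⟩))
        exact ⟨h4.1, h5.2, h4.2⟩
      · rintro ⟨hx, hxJ, hxJ'⟩
        exact ⟨hJY (Finset.mem_filter.2 ⟨hx, hxJ⟩), hJY' (Finset.mem_filter.2 ⟨hx, hxJ'⟩)⟩
    refine hdead _ hJJ Y hY Y' hY' ?_ (h1.symm.trans h2) (h3.trans h1)
    rintro rfl
    rw [Finset.inter_self] at h3
    have h6 := card_filter_of_rainbow (hχ X₀ hX₀) (hkG X₀ hX₀) (J ∩ J')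
    have h7 := Finset.card_le_card (Finset.inter_subset_left : J ∩ J' ⊆ J)
    have h8 := hcardJ J (hproper J hJ)
    have h9 := hkG Y hY
    rw [h3] at h9
    simp only [p] at h9
    omega
  have hsize : ∀ J ∈ 𝒥, J.card ≠ t - 1 := by
    intro J hJ hJt
    refine hF (p J X₀) ?_ ((hker J hJ X₀ hX₀).mono hGF)
    rw [← hJt]
    exact card_filter_of_rainbow (hχ X₀ hX₀) (hkG X₀ hX₀) J
  by_cases hcov : ∃ K : Finset (Fin k), K.card = k - t - 1 ∧ ∀ J ∈ 𝒥, ¬ K ⊆ J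
  · left
    obtain ⟨K, hK, hKJ⟩ := hcov
    -- Two sets with the same trace on `K` would intersect in a set whose type contains `K` and is
    -- dead, which is impossible.
    have hGc : G.card ≤ (Fintype.card α).choose (k - t - 1) := by
      rw [← Finset.card_univ, ← Finset.card_powersetCard]
      refine Finset.card_le_card_of_injOn (p K) (fun X hX => ?_) fun X hX Y hY hXY => ?_
      · refine Finset.mem_coe.2 (Finset.mem_powersetCard.2 ⟨Finset.subset_univ _, ?_⟩)
        rw [← hK]
        exact card_filter_of_rainbow (hχ X hX) (hkG X hX) K
      · by_contra hne'
        have h1 : p ((X ∩ Y).image χ) X = X ∩ Y :=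
          filter_eq_of_image_eq (hχ X hX) Finset.inter_subset_left
        have h2 : p ((X ∩ Y).image χ) Y = X ∩ Y :=
          filter_eq_of_image_eq (hχ Y hY) Finset.inter_subset_right
        refine hdead ((X ∩ Y).image χ) (fun h => hKJ _ h ?_) X hX Y hY hne' (h1.trans h2.symm)
          h1.symm
        have h3 : (p K X).image χ = K := image_filter_of_rainbow (hχ X hX) (hkG X hX) K
        rw [← h3]
        refine Finset.image_subset_image (Finset.subset_inter (hpsub K X) ?_)
        rw [hXY]
        exact hpsub K Y
    calc F.card ≤ k ^ k * G₀.card := hcard₀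
      _ ≤ k ^ k * ((2 ^ k * (m * k)) ^ (2 ^ k) * G.card) := Nat.mul_le_mul_left _ hcard
      _ ≤ k ^ k * ((2 ^ k * (m * k)) ^ (2 ^ k) * (Fintype.card α).choose (k - t - 1)) :=
          Nat.mul_le_mul_left _ (Nat.mul_le_mul_left _ hGc)
      _ = _ := by ring
  · right
    push Not at hcov
    have hcompl : ∀ A : Finset (Fin k), Aᶜ.card = k - A.card := fun A => by
      rw [Finset.card_compl, Fintype.card_fin]
    -- Under complementation intersections become unions, the covered `(k-t-1)`-sets become the
    -- `(t+1)`-sets that contain a member, and the missing size `t - 1` becomes `k - t + 1`.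
    obtain ⟨D, hD, hDs⟩ := exists_card_eq_forall_singleton_of_union_closed
      (fun A : Finset (Fin k) => Aᶜ ∈ 𝒥) t (by simpa using hkt)
      (fun A B hA hB => by
        rw [Finset.compl_union]
        exact hinter _ hA _ hB)
      (fun T hT => by
        obtain ⟨J, hJ, hTJ⟩ := hcov Tᶜ (by rw [hcompl]; omega)
        refine ⟨Jᶜ, compl_le_of_compl_le hTJ, ?_, by simpa using hJ⟩
        rw [Finset.nonempty_iff_ne_empty, Ne, Finset.compl_eq_empty_iff]
        exact hproper J hJ)
      (fun A hA hAc => by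
        refine hsize _ hA ?_
        rw [hcompl, hAc, Fintype.card_fin]
        omega)
    -- Every proper colour set containing `D` is an intersection of complements of single colours
    -- outside `D`.
    have hup : ∀ U : Finset (Fin k), U.Nonempty → Disjoint U D → Uᶜ ∈ 𝒥 := by
      intro U hU
      induction hU using Finset.Nonempty.cons_induction with
      | singleton a =>
        intro h
        exact hDs a (Finset.disjoint_singleton_left.1 h)
      | cons a s ha hs ih =>
        intro h
        rw [Finset.cons_eq_insert, Finset.disjoint_insert_left] at h
        rw [Finset.cons_eq_insert, Finset.insert_eq, Finset.compl_union]
        exact hinter _ (hDs a h.1) _ (ih h.2)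
    refine ⟨X₀, hGF hX₀, p D X₀, hpsub _ _, ?_, fun S hDS hSX => ?_⟩
    · rw [← hD]
      exact card_filter_of_rainbow (hχ X₀ hX₀) (hkG X₀ hX₀) D
    · have h1 : p (S.image χ) X₀ = S := filter_eq_of_image_eq (hχ X₀ hX₀) hSX.subset
      have h2 : S.image χ ∈ 𝒥 := by
        rw [← compl_compl (S.image χ)]
        refine hup _ ?_ ?_
        · rw [Finset.nonempty_iff_ne_empty, Ne, Finset.compl_eq_empty_iff]
          intro h
          have h3 := Finset.card_lt_card hSX
          have h4 : (S.image χ).card ≤ S.card := Finset.card_image_le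
          rw [h, Finset.card_univ, Fintype.card_fin] at h4
          rw [hkG _ hX₀] at h3
          omega
        · rw [disjoint_compl_left_iff]
          have h5 : (p D X₀).image χ = D := image_filter_of_rainbow (hχ X₀ hX₀) (hkG X₀ hX₀) D
          rw [← h5]
          exact Finset.image_subset_image hDS
      have := hker _ h2 X₀ hX₀
      rw [h1] at this
      exact this.mono hGF

/-! ### Comparison with `sunflowerPhi` -/

theorem IsSunflower.isKernel {α : Type*} [DecidableEq α] {F S : Finset (Finset α)}
    {C : Finset α} (hS : S ⊆ F) (h : IsSunflower S C) : IsKernel F S.card C :=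
  ⟨S, hS, rfl, fun B hB x hx => (h.1 x).1 hx B hB, h.2⟩

theorem HasSunflower.exists_isKernel {α : Type*} [DecidableEq α] {F : Finset (Finset α)} {s : ℕ}
    (h : HasSunflower s F) : ∃ C, IsKernel F s C := by
  obtain ⟨S, hS, rfl, C, hC⟩ := h
  exact ⟨C, hC.isKernel hS⟩

theorem IsKernel.hasSunflower {α : Type*} [DecidableEq α] {F : Finset (Finset α)} {s : ℕ}
    {C : Finset α} (hs : 2 ≤ s) (h : IsKernel F s C) : HasSunflower s F := by
  obtain ⟨S, hS, hc, C, -, h⟩ := h.hasSunflowerWithCoreCard hs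
  exact ⟨S, hS, hc, C, h⟩

theorem IsKernel.of_image {α β : Type*} [DecidableEq α] [DecidableEq β]
    {F : Finset (Finset α)} {G : Finset (Finset β)} {s : ℕ} {C : Finset α}
    (h : IsKernel F s C) (f : Finset α → Finset β) (C' : Finset β) (hf : ∀ A ∈ F, f A ∈ G)
    (hinj : ∀ A ∈ F, ∀ B ∈ F, f A = f B → A = B) (hsub : ∀ A ∈ F, C ⊆ A → C' ⊆ f A)
    (hinter : ∀ A ∈ F, ∀ B ∈ F, A ∩ B = C → f A ∩ f B = C') : IsKernel G s C' := by
  obtain ⟨S, hS, hc, h1, h2⟩ := h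
  refine ⟨S.image f, ?_, ?_, ?_, ?_⟩
  · intro B hB
    obtain ⟨A, hA, rfl⟩ := Finset.mem_image.1 hB
    exact hf A (hS hA)
  · rw [Finset.card_image_of_injOn fun A hA B hB h => hinj A (hS hA) B (hS hB) h, hc]
  · intro B hB
    obtain ⟨A, hA, rfl⟩ := Finset.mem_image.1 hB
    exact hsub A (hS hA) (h1 A hA)
  · intro B hB B' hB' hne
    obtain ⟨A, hA, rfl⟩ := Finset.mem_image.1 hB
    obtain ⟨A', hA', rfl⟩ := Finset.mem_image.1 hB'
    exact hinter A (hS hA) A' (hS hA') (h2 A hA A' hA' fun h => hne (h ▸ rfl))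

/-- The sunflower lemma of Erdős and Rado, without an explicit bound. -/
theorem exists_card_le_of_forall_not_isKernel {α : Type*} [DecidableEq α] (s t : ℕ) :
    ∃ N, ∀ T : Finset (Finset α), (∀ A ∈ T, A.card = t) → (∀ C, ¬ IsKernel T s C) →
      T.card ≤ N := by
  induction t with
  | zero =>
    refine ⟨1, fun T hT _ => Finset.card_le_one.2 fun A hA B hB => ?_⟩
    rw [Finset.card_eq_zero.1 (hT A hA), Finset.card_eq_zero.1 (hT B hB)]
  | succ t ih =>
    obtain ⟨N, hN⟩ := ih
    refine ⟨s * (t + 1) * N, fun T hT hker => ?_⟩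
    rcases T.eq_empty_or_nonempty with rfl | hne
    · simp
    obtain ⟨x, -, hx⟩ := exists_popular_point s (t + 1) ∅ T hne hT
      (fun A hA => Finset.empty_ssubset.2 (Finset.card_pos.1 (by rw [hT A hA]; omega))) (hker ∅)
    refine hx.trans (Nat.mul_le_mul_left _ ?_)
    -- The link of the popular point `x` is `t`-uniform, and adding `x` back lifts its sunflowers to
    -- `T`.
    have hmem : ∀ A ∈ (T.filter fun A => x ∈ A).image fun A => A.erase x,
        x ∉ A ∧ insert x A ∈ T := by
      intro A hA
      obtain ⟨B, hB, rfl⟩ := Finset.mem_image.1 hA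
      obtain ⟨hBT, hxB⟩ := Finset.mem_filter.1 hB
      exact ⟨Finset.notMem_erase x B, by rwa [Finset.insert_erase hxB]⟩
    have hinj : Set.InjOn (fun A : Finset α => A.erase x) (T.filter fun A => x ∈ A) := by
      intro A hA B hB h
      have hA' := (Finset.mem_filter.1 hA).2
      have hB' := (Finset.mem_filter.1 hB).2
      rw [← Finset.insert_erase hA', ← Finset.insert_erase hB']
      exact congrArg (insert x) h
    rw [← Finset.card_image_of_injOn hinj]
    refine hN _ (fun A hA => ?_) fun C hC => hker (insert x C) (hC.of_image (insert x) _
      (fun A hA => (hmem A hA).2) (fun A hA B hB h => ?_)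
      (fun A _ h => Finset.insert_subset_insert x h) fun A _ B _ h => ?_)
    · have h1 := hT _ (hmem A hA).2
      rw [Finset.card_insert_of_notMem (hmem A hA).1] at h1
      omega
    · rw [← Finset.erase_insert (hmem A hA).1, ← Finset.erase_insert (hmem B hB).1, h]
    · rw [← Finset.insert_inter_distrib, h]

theorem card_le_sunflowerPhi {α : Type*} [Fintype α] [DecidableEq α] (s t : ℕ) (hs : 2 ≤ s)
    (T : Finset (Finset α)) (hT : ∀ A ∈ T, A.card = t) (hker : ∀ C, ¬ IsKernel T s C) :
    T.card ≤ sunflowerPhi s t := by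
  obtain ⟨N, hN⟩ := exists_card_le_of_forall_not_isKernel (α := ℕ) s t
  -- Boundedness is essential: on an unbounded set of naturals `sSup` is `0`.
  refine le_csSup ⟨N, ?_⟩ ?_
  · rintro _ ⟨T, hT, hsun, rfl⟩
    exact hN T hT fun C hC => hsun (hC.hasSunflower hs)
  · let e : α ↪ ℕ := (Fintype.equivFin α).toEmbedding.trans Fin.valEmbedding
    refine ⟨T.map (Finset.mapEmbedding e).toEmbedding, ?_, fun hsun => ?_, Finset.card_map _⟩
    · intro A hA
      obtain ⟨B, hB, rfl⟩ := Finset.mem_map.1 hA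
      simpa using hT B hB
    · obtain ⟨C, hC⟩ := hsun.exists_isKernel
      have hpre : ∀ A ∈ T.map (Finset.mapEmbedding e).toEmbedding, ∃ B ∈ T, A = B.map e := by
        intro A hA
        obtain ⟨B, hB, rfl⟩ := Finset.mem_map.1 hA
        exact ⟨B, hB, rfl⟩
      have hback : ∀ B : Finset α, (B.map e).preimage e e.injective.injOn = B := fun B => by
        ext x
        simp
      refine hker (C.preimage e e.injective.injOn)
        (hC.of_image (fun A => A.preimage e e.injective.injOn) _ ?_ ?_ ?_ ?_)
      · intro A hA
        obtain ⟨B, hB, rfl⟩ := hpre A hA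
        rwa [hback]
      · intro A hA A' hA' h
        obtain ⟨B, hB, rfl⟩ := hpre A hA
        obtain ⟨B', hB', rfl⟩ := hpre A' hA'
        rw [hback, hback] at h
        rw [h]
      · intro A _ h x hx
        rw [Finset.mem_preimage] at hx ⊢
        exact h hx
      · intro A _ A' _ h
        ext x
        simp [← h]

/-! ### Lifting sunflowers and counting good and bad sets -/

/-- Greedy choice: the petals of each kernel outnumber the points of `W` and of the sets already
chosen. -/
theorem exists_extension_inter_subset {α ι : Type*} [DecidableEq α] [DecidableEq ι]
    (F : Finset (Finset α)) (k m : ℕ) (hk0 : 0 < k) (hk : ∀ X ∈ F, X.card = k)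
    (K : ι → Finset α) (W : Finset α) (S : Finset ι) (hW : W.card + S.card * k ≤ m)
    (hKW : ∀ i ∈ S, K i ⊆ W) (hker : ∀ i ∈ S, IsKernel F m (K i)) :
    ∃ g : ι → Finset α, (∀ i ∈ S, g i ∈ F ∧ K i ⊆ g i ∧ g i ∩ W ⊆ K i) ∧
      ∀ i ∈ S, ∀ j ∈ S, i ≠ j → g i ∩ g j ⊆ K i ∩ K j := by
  induction S using Finset.induction_on with
  | empty => exact ⟨fun _ => ∅, by simp, by simp⟩
  | insert a S ha ih =>
    rw [Finset.card_insert_of_notMem ha, Nat.add_mul, Nat.one_mul] at hW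
    obtain ⟨g, hg, hgg⟩ := ih (by omega) (fun i hi => hKW i (Finset.mem_insert_of_mem hi))
      (fun i hi => hker i (Finset.mem_insert_of_mem hi))
    have hQ : (W ∪ S.biUnion g).card < m := by
      have h1 := Finset.card_union_le W (S.biUnion g)
      have h2 : (S.biUnion g).card ≤ S.card * k :=
        Finset.card_biUnion_le_card_mul _ _ _ fun i hi => (hk _ (hg i hi).1).le
      omega
    obtain ⟨B, hB, hKB, hBQ⟩ := (hker a (Finset.mem_insert_self _ _)).exists_disjoint _ hQ
    have hBg : ∀ i ∈ S, B ∩ g i ⊆ K a ∩ K i := by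
      intro i hi x hx
      obtain ⟨h1, h2⟩ := Finset.mem_inter.1 hx
      have h3 : x ∈ K a := hBQ (Finset.mem_inter.2
        ⟨h1, Finset.mem_union_right _ (Finset.mem_biUnion.2 ⟨i, hi, h2⟩)⟩)
      exact Finset.mem_inter.2 ⟨h3, (hg i hi).2.2
        (Finset.mem_inter.2 ⟨h2, hKW a (Finset.mem_insert_self _ _) h3⟩)⟩
    have hne : ∀ i ∈ S, i ≠ a := fun i hi h => ha (h ▸ hi)
    refine ⟨Function.update g a B, fun i hi => ?_, fun i hi j hj hij => ?_⟩
    · rcases Finset.mem_insert.1 hi with rfl | hi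
      · rw [Function.update_self]
        exact ⟨hB, hKB, fun x hx => hBQ (Finset.mem_inter.2 ⟨(Finset.mem_inter.1 hx).1,
          Finset.mem_union_left _ (Finset.mem_inter.1 hx).2⟩)⟩
      · rw [Function.update_of_ne (hne i hi)]
        exact hg i hi
    · rcases Finset.mem_insert.1 hi with rfl | hiS <;> rcases Finset.mem_insert.1 hj with rfl | hjS
      · exact absurd rfl hij
      · rw [Function.update_self, Function.update_of_ne (hne j hjS)]
        exact hBg j hjS
      · rw [Function.update_self, Function.update_of_ne (hne i hiS), Finset.inter_comm,
          Finset.inter_comm (K i)]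
        exact hBg i hiS
      · rw [Function.update_of_ne (hne i hiS), Function.update_of_ne (hne j hjS)]
        exact hgg i hiS j hjS hij

/-- A sunflower among the sets `D` all of whose extensions inside `D ∪ E` are kernels of `F`
gives a sunflower in `F` whose core has size `t - 1`. -/
theorem hasSunflowerWithCoreCard_of_isKernel {α : Type*} [DecidableEq α] (s t k : ℕ) (hs : 2 ≤ s)
    (ht : 1 ≤ t) (hkt : 2 * t + 1 ≤ k) (F : Finset (Finset α)) (hk : ∀ X ∈ F, X.card = k)
    (E : Finset α) (hE : E.card = k - t) (T : Finset (Finset α)) (hT : ∀ D ∈ T, D.card = t)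
    (hTE : ∀ D ∈ T, Disjoint D E)
    (hker : ∀ D ∈ T, ∀ S, D ⊆ S → S ⊂ D ∪ E → IsKernel F (2 * (s * k)) S)
    (C : Finset α) (hC : IsKernel T s C) : HasSunflowerWithCoreCard s (t - 1) F := by
  obtain ⟨S, hST, hSc, hCS, hS⟩ := hC
  have hCt : C.card < t := by
    obtain ⟨A, hA, B, hB, hne⟩ := Finset.one_lt_card.1 (by omega : 1 < S.card)
    rw [← hT A (hST hA)]
    refine Finset.card_lt_card ((hCS A hA).ssubset_of_ne fun h => hne ?_)
    refine Finset.eq_of_subset_of_card_le (h ▸ hCS B hB) ?_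
    rw [hT A (hST hA), hT B (hST hB)]
  -- Padding by `E'` raises the core to size `t - 1`; `E` is large enough because `k ≥ 2t + 1`.
  obtain ⟨E', hE', hE'c⟩ := Finset.exists_subset_card_eq (by omega : t - 1 - C.card ≤ E.card)
  have hdisj : ∀ D ∈ S, Disjoint D E' := fun D hD =>
    Finset.disjoint_of_subset_right hE' (hTE D (hST hD))
  have hKc : ∀ D ∈ S, (D ∪ E').card ≤ k := fun D hD => by
    have h1 := Finset.card_union_le D E'
    have h2 := hT D (hST hD)
    omega
  have hCE : (C ∪ E').card = t - 1 := by
    obtain ⟨A, hA⟩ := Finset.card_pos.1 (by omega : 0 < S.card)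
    rw [Finset.card_union_of_disjoint (Finset.disjoint_of_subset_left (hCS A hA) (hdisj A hA))]
    omega
  obtain ⟨g, hg, hgg⟩ := exists_extension_inter_subset F k (2 * (s * k)) (by omega) hk
    (fun D => D ∪ E') (S.biUnion fun D => D ∪ E') S
    (by
      have h1 : (S.biUnion fun D => D ∪ E').card ≤ S.card * k :=
        Finset.card_biUnion_le_card_mul _ _ _ hKc
      rw [hSc] at h1 ⊢
      omega)
    (fun D hD => Finset.subset_biUnion_of_mem (fun D => D ∪ E') hD)
    (fun D hD => by
      refine hker D (hST hD) _ Finset.subset_union_left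
        ((Finset.union_subset_union_right hE').ssubset_of_ne fun h => ?_)
      have h1 := congrArg Finset.card h
      rw [Finset.card_union_of_disjoint (hdisj D hD),
        Finset.card_union_of_disjoint (hTE D (hST hD))] at h1
      omega)
  have hinter : ∀ A ∈ S, ∀ B ∈ S, A ≠ B → g A ∩ g B = C ∪ E' := by
    intro A hA B hB hne
    have h1 : (A ∪ E') ∩ (B ∪ E') = C ∪ E' := by
      rw [← Finset.inter_union_distrib_right, hS A hA B hB hne]
    refine Finset.Subset.antisymm (h1 ▸ hgg A hA B hB hne) ?_
    rw [← h1]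
    exact Finset.inter_subset_inter (hg A hA).2.1 (hg B hB).2.1
  have hinj : Set.InjOn g S := by
    intro A hA B hB h
    by_contra hne
    have h1 := hinter A hA B hB hne
    rw [← h, Finset.inter_self] at h1
    have h2 := hk _ (hg A hA).1
    rw [h1, hCE] at h2
    omega
  rw [← hCE]
  refine IsKernel.hasSunflowerWithCoreCard (m := s)
    ⟨S.image g, ?_, by rw [Finset.card_image_of_injOn hinj, hSc], ?_, ?_⟩ hs
  · intro X hX
    obtain ⟨A, hA, rfl⟩ := Finset.mem_image.1 hX
    exact (hg A hA).1
  · intro X hX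
    obtain ⟨A, hA, rfl⟩ := Finset.mem_image.1 hX
    exact (Finset.union_subset_union_left (hCS A hA)).trans (hg A hA).2.1
  · intro X hX Y hY hne
    obtain ⟨A, hA, rfl⟩ := Finset.mem_image.1 hX
    obtain ⟨B, hB, rfl⟩ := Finset.mem_image.1 hY
    exact hinter A hA B hB fun h => hne (h ▸ rfl)

theorem card_le_sunflowerPhi_mul_choose_add {α : Type*} [Fintype α] [DecidableEq α]
    (s t k : ℕ) (hs : 2 ≤ s) (ht : 1 ≤ t) (hkt : 2 * t + 1 ≤ k) (F : Finset (Finset α))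
    (hk : ∀ X ∈ F, X.card = k) (hF : ¬ HasSunflowerWithCoreCard s (t - 1) F) :
    F.card ≤ sunflowerPhi s t * (Fintype.card α).choose (k - t) +
      k ^ k * (2 ^ k * (2 * (s * k) * k)) ^ (2 ^ k) * (Fintype.card α).choose (k - t - 1) := by
  classical
  have hsk : 2 * k ≤ s * k := Nat.mul_le_mul_right k hs
  have hss : s ≤ s * k := Nat.le_mul_of_pos_right s (by omega)
  -- One `s * k` pays for the union of the `s` padded kernels, the other for the `s` sets chosen
  -- greedily.
  set m := 2 * (s * k) with hm
  let good : Finset α → Prop := fun X =>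
    ∃ D ⊆ X, D.card = t ∧ ∀ S, D ⊆ S → S ⊂ X → IsKernel F m S
  have hbad : (F.filter fun X => ¬ good X).card ≤
      k ^ k * (2 ^ k * (m * k)) ^ (2 ^ k) * (Fintype.card α).choose (k - t - 1) := by
    rcases (F.filter fun X => ¬ good X).eq_empty_or_nonempty with h | hne
    · rw [h]
      simp
    refine (card_le_or_exists_kernel_system m k t ht hkt (by omega) _ hne
      (fun X hX => hk X (Finset.mem_filter.1 hX).1) ?_).resolve_right ?_
    · intro A hA hAk
      rw [← hA] at hF
      exact hF (((hAk.mono (Finset.filter_subset _ _)).of_le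
        (by omega)).hasSunflowerWithCoreCard hs)
    · rintro ⟨X, hX, D, hDX, hD, h⟩
      exact (Finset.mem_filter.1 hX).2
        ⟨D, hDX, hD, fun S h1 h2 => (h S h1 h2).mono (Finset.filter_subset _ _)⟩
  have hD : ∀ X, ∃ D : Finset α, X ∈ F.filter good →
      D ⊆ X ∧ D.card = t ∧ ∀ S, D ⊆ S → S ⊂ X → IsKernel F m S := by
    intro X
    by_cases hX : X ∈ F.filter good
    · obtain ⟨D, h⟩ := (Finset.mem_filter.1 hX).2
      exact ⟨D, fun _ => h⟩
    · exact ⟨∅, fun h => absurd h hX⟩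
  choose D hD using hD
  have hgood : (F.filter good).card ≤
      sunflowerPhi s t * (Fintype.card α).choose (k - t) := by
    rw [← Finset.card_univ, ← Finset.card_powersetCard]
    refine Finset.card_le_mul_card_image_of_maps_to (f := fun X => X \ D X) ?_ _ ?_
    · intro X hX
      refine Finset.mem_powersetCard.2 ⟨Finset.subset_univ _, ?_⟩
      rw [Finset.card_sdiff_of_subset (hD X hX).1, (hD X hX).2.1,
        hk X (Finset.mem_filter.1 hX).1]
    · intro E hE
      have hEc := (Finset.mem_powersetCard.1 hE).2
      set H := (F.filter good).filter fun X => X \ D X = E with hH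
      have hHX : ∀ X ∈ H, X ∈ F.filter good ∧ X = D X ∪ E := by
        intro X hX
        obtain ⟨h1, h2⟩ := Finset.mem_filter.1 hX
        exact ⟨h1, by rw [← h2, Finset.union_sdiff_of_subset (hD X h1).1]⟩
      have hinj : Set.InjOn D H := by
        intro X hX Y hY h
        rw [(hHX X hX).2, (hHX Y hY).2, h]
      rw [← Finset.card_image_of_injOn hinj]
      have himg : ∀ B ∈ H.image D, B.card = t ∧ Disjoint B E ∧
          ∀ S, B ⊆ S → S ⊂ B ∪ E → IsKernel F m S := by
        intro B hB
        obtain ⟨X, hX, rfl⟩ := Finset.mem_image.1 hB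
        obtain ⟨h1, h2⟩ := hHX X hX
        obtain ⟨h3, h4, h5⟩ := hD X h1
        refine ⟨h4, ?_, ?_⟩
        · rw [← (Finset.mem_filter.1 hX).2]
          exact Finset.disjoint_sdiff
        · rwa [← h2]
      exact card_le_sunflowerPhi s t hs _ (fun B hB => (himg B hB).1) fun C hC =>
        hF (hasSunflowerWithCoreCard_of_isKernel s t k hs ht hkt F hk E hEc _
          (fun B hB => (himg B hB).1) (fun B hB => (himg B hB).2.1)
          (fun B hB => (himg B hB).2.2) C hC)
  have := Finset.card_filter_add_card_filter_not (s := F) good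
  omega

/-! ### Constants and conclusion -/

/-- With `x = 2 ^ k ≥ 8`, the exponent of `2` is at most `5 * x ^ 2 ≤ x ^ 4`, whence the absolute
constant `4`. -/
theorem homogeneity_constant_le (s k : ℕ) (hk : 3 ≤ k) :
    k ^ k * (2 ^ k * (2 * (s * k) * k)) ^ (2 ^ k) ≤ s ^ (2 ^ k) * 2 ^ (2 ^ (4 * k)) := by
  have hkx : k ≤ 2 ^ k := Nat.lt_two_pow_self.le
  have hx : 8 ≤ 2 ^ k := (Nat.pow_le_pow_right (by norm_num) hk : 2 ^ 3 ≤ 2 ^ k)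
  have h1 : 2 ^ k * (2 * (s * k) * k) ≤ s * 2 ^ (3 * k + 1) := by
    calc 2 ^ k * (2 * (s * k) * k) = s * (2 ^ k * 2 * (k * k)) := by ring
      _ ≤ s * (2 ^ k * 2 * (2 ^ k * 2 ^ k)) := by gcongr
      _ = s * 2 ^ (3 * k + 1) := by ring
  have h2 : k * k + (3 * k + 1) * 2 ^ k ≤ 2 ^ (4 * k) := by
    have h3 : 2 ^ (4 * k) = (2 ^ k) ^ 4 := by rw [← pow_mul, mul_comm]
    rw [h3]
    generalize 2 ^ k = x at hkx hx
    calc k * k + (3 * k + 1) * x ≤ x * x + (3 * x + x) * x := by gcongr; omega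
      _ = 5 * (x * x) := by ring
      _ ≤ (x * x) * (x * x) := Nat.mul_le_mul_right _ (by nlinarith)
      _ = x ^ 4 := by ring
  calc k ^ k * (2 ^ k * (2 * (s * k) * k)) ^ (2 ^ k)
      ≤ (2 ^ k) ^ k * (s * 2 ^ (3 * k + 1)) ^ (2 ^ k) := by gcongr
    _ = s ^ (2 ^ k) * 2 ^ (k * k + (3 * k + 1) * 2 ^ k) := by
        rw [mul_pow, ← pow_mul, ← pow_mul, pow_add]
        ring
    _ ≤ s ^ (2 ^ k) * 2 ^ (2 ^ (4 * k)) := by gcongr; norm_num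

theorem choose_pred_le_div_mul_choose (n k t : ℕ) (hkt : 2 * t + 1 ≤ k) (hkn : k < n) :
    (n.choose (k - t - 1) : ℝ) ≤ (k : ℝ) / ((n : ℝ) - k) * (n.choose (k - t) : ℝ) := by
  have h1 : n.choose (k - t) * (k - t) = n.choose (k - t - 1) * (n - (k - t - 1)) := by
    have := Nat.choose_succ_right_eq n (k - t - 1)
    rwa [show k - t - 1 + 1 = k - t by omega] at this
  have h2 : n.choose (k - t - 1) * (n - k) ≤ k * n.choose (k - t) := by
    calc n.choose (k - t - 1) * (n - k) ≤ n.choose (k - t - 1) * (n - (k - t - 1)) :=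
          Nat.mul_le_mul_left _ (by omega)
      _ = n.choose (k - t) * (k - t) := h1.symm
      _ ≤ n.choose (k - t) * k := Nat.mul_le_mul_left _ (by omega)
      _ = k * n.choose (k - t) := Nat.mul_comm _ _
  have h3 : (0 : ℝ) < (n : ℝ) - k := by
    rw [sub_pos]
    exact_mod_cast hkn
  rw [div_mul_eq_mul_div, le_div_iff₀ h3, ← Nat.cast_sub hkn.le]
  exact_mod_cast h2

theorem mainTheorem10 :
    ∃ c : ℕ → ℕ → ℝ,
      (∃ C : ℝ, 0 < C ∧
        ∀ s k : ℕ, c s k ≤ (s : ℝ) ^ (2 ^ k) * (2 : ℝ) ^ ((2 : ℝ) ^ (C * (k : ℝ)))) ∧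
      ∀ s t k n : ℕ, 2 ≤ s → 1 ≤ t → 2 * t + 1 ≤ k → k < n →
        ∀ F : Finset (Finset (Fin n)),
          (∀ A ∈ F, A.card = k) →
          ¬ HasSunflowerWithCoreCard s (t - 1) F →
          (F.card : ℝ) ≤
            (sunflowerPhi s t : ℝ) * (n.choose (k - t) : ℝ) +
              (k : ℝ) * c s k / ((n : ℝ) - (k : ℝ)) * (n.choose (k - t) : ℝ) := by
  refine ⟨fun s k => ((s ^ (2 ^ k) * 2 ^ (2 ^ (4 * k)) : ℕ) : ℝ), ⟨4, by norm_num, ?_⟩, ?_⟩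
  · intro s k
    have h1 : (2 : ℝ) ^ (4 * (k : ℝ)) = ((2 ^ (4 * k) : ℕ) : ℝ) := by
      rw [Nat.cast_pow, Nat.cast_ofNat, ← Real.rpow_natCast]
      norm_num
    rw [h1, Real.rpow_natCast]
    push_cast
    exact le_rfl
  · intro s t k n hs ht hkt hkn F hk hF
    have h1 := card_le_sunflowerPhi_mul_choose_add s t k hs ht hkt F hk hF
    have h2 := Nat.mul_le_mul_right (n.choose (k - t - 1))
      (homogeneity_constant_le s k (by omega))
    rw [Fintype.card_fin] at h1
    have h3 := choose_pred_le_div_mul_choose n k t hkt hkn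
    have h4 : (F.card : ℝ) ≤ (sunflowerPhi s t : ℝ) * (n.choose (k - t) : ℝ) +
        ((s ^ (2 ^ k) * 2 ^ (2 ^ (4 * k)) : ℕ) : ℝ) * (n.choose (k - t - 1) : ℝ) := by
      exact_mod_cast h1.trans (Nat.add_le_add_left h2 _)
    refine h4.trans (add_le_add_right ?_ _)
    calc ((s ^ (2 ^ k) * 2 ^ (2 ^ (4 * k)) : ℕ) : ℝ) * (n.choose (k - t - 1) : ℝ)
        ≤ ((s ^ (2 ^ k) * 2 ^ (2 ^ (4 * k)) : ℕ) : ℝ) *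
          ((k : ℝ) / ((n : ℝ) - k) * (n.choose (k - t) : ℝ)) :=
          mul_le_mul_of_nonneg_left h3 (Nat.cast_nonneg _)
      _ = _ := by ring
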